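/- Let $T$ be the ternary rooted tree, whose vertices are the finite words over $\{1,2,3\}$, and write an automorphism $g$ of $T$ as $g=(g_1,g_2,g_3)\alpha$, where $\alpha\in S_3$ is the action of $g$ on the first level and $g_i$ is the section of $g$ at the vertex $i$, that is, $g(iw)=\alpha(i)\,g_i(w)$ for all words $w$; more generally the section $g_u$ at a vertex $u$ is defined by $g(uw)=g(u)\,g_u(w)$. The Apollonian group $A$ is the group generated by the automorphisms of $T$ defined by $$x=(1,y,1)(1\,2),\qquad y=(x,1,1)(1\,3),\qquad z=(1,1,z)(2\,3).$$ A group $G$ of automorphisms of $T$ is self-similar if all sections of its elements belong to $G$. A self-similar group $G$ is contracting if there is a finite set $\mathcal M\subseteq G$ such that for every $g\in G$ there is a level $n$ such that $g_u\in\mathcal M$ for every vertex $u$ at or below level $n$; the smallest such set is the nucleus $\mathcal N$ of $G$. The portrait of $g\in G$ is the finite decorated tree defined recursively as follows: if $g\in\mathcal N$, it is a single vertex decorated by $g$; otherwise its root is decorated by the permutation $\alpha$ in $g=(g_1,g_2,g_3)\alpha$, and the portraits of $g_1,g_2,g_3$ are attached below the root. The depth $d(g)$ is the length of the longest path from the root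 to a leaf in the portrait of $g$, and the portrait growth sequence of $G$ is $a_n=|\{g\in G : d(g)\le n\}|$, $n\ge 0$. Theorem. The Apollonian group $A$ is contracting, and its portrait growth sequence is given, for all $n\ge 0$, by $$a_n=3^{\frac{3^n-1}{2}}\cdot 7^{3^n}=\frac{1}{\sqrt3}\left(7\sqrt3\right)^{3^n}.$$ -/

import Mathlib

/-! The regular rooted tree over an alphabet `X` has the words `List X` as vertices; the root is the
empty word, and the children of `u` are the words `u ++ [a]` with `a : X`. -/

/-- `v` is a child of `u` in the rooted tree of words: `v = u a` for a letter `a`. -/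
def IsChild {X : Type*} (u v : List X) : Prop := ∃ a : X, v = u ++ [a]

/-- The automorphism group of the rooted tree of words over `X`. Multiplication is composition of
maps, `(g * h) w = g (h w)`. -/
def TreeAut (X : Type*) : Subgroup (Equiv.Perm (List X)) where
  carrier := {g | ∀ u v, IsChild (g u) (g v) ↔ IsChild u v}
  one_mem' := fun _ _ => Iff.rfl
  mul_mem' := fun {g h} hg hh u v => (hg (h u) (h v)).trans (hh u v)
  inv_mem' := fun {g} hg u v => by
    have h := hg (g⁻¹ u) (g⁻¹ v)
    simpa using h.symm

namespace TreeAut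

variable {X : Type*}

theorem isChild_iff (g : TreeAut X) (u v : List X) :
    IsChild (g.1 u) (g.1 v) ↔ IsChild u v := g.2 u v

theorem apply_nil (g : TreeAut X) : g.1 [] = [] := by
  rcases List.eq_nil_or_concat (g.1 []) with h | ⟨w, b, h⟩
  · exact h
  · exfalso
    have h1 : IsChild (g.1 (g.1.symm w)) (g.1 []) := ⟨b, by simpa using h⟩
    obtain ⟨a, ha⟩ := (isChild_iff g _ _).1 h1
    simp at ha

theorem length_apply (g : TreeAut X) (w : List X) : (g.1 w).length = w.length := by
  induction w using List.reverseRecOn with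
  | nil => simp [apply_nil]
  | append_singleton w a ih =>
    obtain ⟨b, hb⟩ := (isChild_iff g w (w ++ [a])).2 ⟨a, rfl⟩
    simp [hb, ih]

/-- An automorphism preserves prefixes: `g (u w)` begins with `g u`. -/
theorem apply_append (g : TreeAut X) (u w : List X) :
    g.1 (u ++ w) = g.1 u ++ (g.1 (u ++ w)).drop u.length := by
  induction w using List.reverseRecOn with
  | nil =>
    have h : (g.1 u).drop u.length = [] := by simp [length_apply]
    simp [h]
  | append_singleton w a ih =>
    obtain ⟨b, hb⟩ := (isChild_iff g (u ++ w) (u ++ w ++ [a])).2 ⟨a, rfl⟩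
    rw [← List.append_assoc, hb, List.drop_append_of_le_length (by simp [length_apply]),
      ← List.append_assoc, ← ih]

/-- The map `w ↦ g_u(w)` determined by `g (u w) = g(u) g_u(w)`. -/
def sectionFun (g : TreeAut X) (u w : List X) : List X := (g.1 (u ++ w)).drop u.length

theorem apply_append' (g : TreeAut X) (u w : List X) :
    g.1 (u ++ w) = g.1 u ++ sectionFun g u w := apply_append g u w

theorem sectionFun_inv_left (g : TreeAut X) (u w : List X) :
    sectionFun g⁻¹ (g.1 u) (sectionFun g u w) = w := by
  have h : (g⁻¹).1 (g.1 u ++ sectionFun g u w) = u ++ w := by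
    rw [← apply_append']
    simp
  unfold sectionFun at h ⊢
  rw [h]
  simp [length_apply]

theorem sectionFun_inv_right (g : TreeAut X) (u w : List X) :
    sectionFun g u (sectionFun g⁻¹ (g.1 u) w) = w := by
  have h := sectionFun_inv_left g⁻¹ (g.1 u) w
  have e : (g⁻¹).1 (g.1 u) = u := by simp
  rwa [inv_inv, e] at h

theorem isChild_append_left (u v w : List X) : IsChild (u ++ v) (u ++ w) ↔ IsChild v w := by
  simp [IsChild, List.append_assoc]

/-- The section `g_u` of `g` at the vertex `u`, given by `g (u w) = g(u) g_u(w)`. -/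
def sec (g : TreeAut X) (u : List X) : TreeAut X :=
  ⟨{ toFun := sectionFun g u
     invFun := sectionFun g⁻¹ (g.1 u)
     left_inv := sectionFun_inv_left g u
     right_inv := sectionFun_inv_right g u },
   fun v w => by
    change IsChild (sectionFun g u v) (sectionFun g u w) ↔ IsChild v w
    rw [← isChild_append_left (g.1 u), ← apply_append', ← apply_append', isChild_iff,
      isChild_append_left]⟩

theorem apply_append_sec (g : TreeAut X) (u w : List X) :
    g.1 (u ++ w) = g.1 u ++ (sec g u).1 w := apply_append' g u w

theorem apply_singleton_ne_nil (g : TreeAut X) (a : X) : g.1 [a] ≠ [] := by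
  intro h
  have := length_apply g [a]
  simp [h] at this

theorem apply_singleton_head (g : TreeAut X) (a : X) :
    g.1 [a] = [(g.1 [a]).head (apply_singleton_ne_nil g a)] := by
  obtain ⟨b, hb⟩ := List.length_eq_one_iff.1 ((length_apply g [a]).trans (by simp))
  simp [hb]

/-- The root permutation `α` of `g`: the permutation of the letters with `g [a] = [α a]`, describing
the action of `g` on the first level. -/
def rootPerm (g : TreeAut X) : Equiv.Perm X where
  toFun a := (g.1 [a]).head (apply_singleton_ne_nil g a)
  invFun a := ((g⁻¹).1 [a]).head (apply_singleton_ne_nil g⁻¹ a)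
  left_inv a := by
    simp only [← apply_singleton_head]
    simp
  right_inv a := by
    simp only [← apply_singleton_head]
    simp

theorem apply_singleton (g : TreeAut X) (a : X) : g.1 [a] = [rootPerm g a] :=
  apply_singleton_head g a

theorem apply_cons (g : TreeAut X) (a : X) (w : List X) :
    g.1 (a :: w) = rootPerm g a :: (sec g [a]).1 w := by
  have h := apply_append_sec g [a] w
  rwa [apply_singleton] at h

/-- `g = (s_a)_{a ∈ X} α`: the root permutation of `g` is `α` and the section of `g` at the
first-level vertex `a` is `s a`. -/
def HasDecomp (g : TreeAut X) (s : X → TreeAut X) (α : Equiv.Perm X) : Prop :=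
  rootPerm g = α ∧ ∀ a, sec g [a] = s a

/-! ### Self-similar and contracting groups, the nucleus -/

/-- All sections of elements of `G` belong to `G`. -/
def IsSelfSimilar (G : Subgroup (TreeAut X)) : Prop :=
  ∀ g ∈ G, ∀ u : List X, sec g u ∈ G

/-- `M` is a finite subset of `G` such that, for every `g ∈ G`, there is a level at and below which
all sections of `g` belong to `M`. -/
def IsContractingSet (G : Subgroup (TreeAut X)) (M : Set (TreeAut X)) : Prop :=
  M.Finite ∧ M ⊆ (G : Set (TreeAut X)) ∧
    ∀ g ∈ G, ∃ n : ℕ, ∀ u : List X, n ≤ u.length → sec g u ∈ M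

/-- A self-similar group is contracting if it has a finite contracting set. -/
def IsContracting (G : Subgroup (TreeAut X)) : Prop :=
  IsSelfSimilar G ∧ ∃ M, IsContractingSet G M

/-- The nucleus of a contracting group: its smallest contracting set (see `isLeast_nucleus`). -/
def nucleus (G : Subgroup (TreeAut X)) : Set (TreeAut X) :=
  ⋂₀ {M | IsContractingSet G M}

theorem IsContractingSet.inter {G : Subgroup (TreeAut X)} {M N : Set (TreeAut X)}
    (hM : IsContractingSet G M) (hN : IsContractingSet G N) : IsContractingSet G (M ∩ N) := by
  refine ⟨hM.1.subset Set.inter_subset_left, Set.inter_subset_left.trans hM.2.1, fun g hg => ?_⟩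
  obtain ⟨m, hm⟩ := hM.2.2 g hg
  obtain ⟨n, hn⟩ := hN.2.2 g hg
  exact ⟨max m n, fun u hu =>
    ⟨hm u ((le_max_left _ _).trans hu), hn u ((le_max_right _ _).trans hu)⟩⟩

theorem isLeast_nucleus {G : Subgroup (TreeAut X)} (h : IsContracting G) :
    IsLeast {M | IsContractingSet G M} (nucleus G) := by
  refine ⟨?_, fun M hM => Set.sInter_subset_of_mem hM⟩
  obtain ⟨-, M, hM⟩ := h
  obtain ⟨N, hN, hmin⟩ := WellFounded.has_min (measure (Set.ncard (α := TreeAut X))).wf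
    {M | IsContractingSet G M} ⟨M, hM⟩
  have key : nucleus G = N := by
    refine (Set.sInter_subset_of_mem hN).antisymm (Set.subset_sInter fun P hP => ?_)
    have h1 : ¬ (N ∩ P).ncard < N.ncard := hmin (N ∩ P) (hN.inter hP)
    have h2 := Set.eq_of_subset_of_ncard_le (Set.inter_subset_left (s := N) (t := P))
      (not_lt.1 h1) hN.1
    exact Set.inter_eq_left.1 h2
  rw [key]
  exact hN

/-! ### Portraits -/

/-- Finite trees whose leaves are decorated by tree automorphisms and whose interior vertices are
decorated by permutations of `X` and have one subtree for every letter in `X`. -/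
inductive Portrait (X : Type*) where
  | leaf (g : TreeAut X) : Portrait X
  | node (α : Equiv.Perm X) (children : X → Portrait X) : Portrait X

/-- The depth of a portrait: the length of the longest ray from the root to a leaf. -/
def Portrait.depth [Fintype X] : Portrait X → ℕ
  | .leaf _ => 0
  | .node _ c => (Finset.univ.sup fun a => (c a).depth) + 1

/-- `IsPortraitOf N P g`: `P` is the portrait of `g` with respect to the set `N`. If `g ∈ N`, the
portrait is the single vertex decorated by `g`; otherwise the root is decorated by the root
permutation of `g`, and the portraits of the sections of `g` at the first level are attached. -/
def IsPortraitOf (N : Set (TreeAut X)) : Portrait X → TreeAut X → Prop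
  | .leaf h, g => g ∈ N ∧ h = g
  | .node α c, g => g ∉ N ∧ α = rootPerm g ∧ ∀ a, IsPortraitOf N (c a) (sec g [a])

/-- The elements of `G` that have a nucleus portrait of depth at most `n`. -/
def depthLE [Fintype X] (G : Subgroup (TreeAut X)) (n : ℕ) : Set (TreeAut X) :=
  {g | g ∈ G ∧ ∃ P, IsPortraitOf (nucleus G) P g ∧ P.depth ≤ n}

/-- The portrait growth sequence of `G` (with respect to the nucleus). -/
noncomputable def portraitGrowth [Fintype X] (G : Subgroup (TreeAut X)) (n : ℕ) : ℕ :=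
  (depthLE G n).ncard

/-- An element has at most one portrait. -/
theorem IsPortraitOf.unique {N : Set (TreeAut X)} {P Q : Portrait X} {g : TreeAut X}
    (hP : IsPortraitOf N P g) (hQ : IsPortraitOf N Q g) : P = Q := by
  induction P generalizing Q g with
  | leaf h =>
    cases Q with
    | leaf k => simp only [IsPortraitOf] at hP hQ; rw [hP.2, hQ.2]
    | node β d => simp only [IsPortraitOf] at hP hQ; exact absurd hP.1 hQ.1
  | node α c ih =>
    cases Q with
    | leaf k => simp only [IsPortraitOf] at hP hQ; exact absurd hQ.1 hP.1
    | node β d =>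
      simp only [IsPortraitOf] at hP hQ
      rw [hP.2.1, hQ.2.1]
      congr 1
      funext a
      exact ih a (hP.2.2 a) (hQ.2.2 a)

/-! ### Tree automorphisms defined by a system of decompositions -/

/-- The map on words given by state `q` of an automaton: the state `q` permutes the first letter by
`out q`, and acts on the rest of a word that begins with `a` as the state `nxt q a`. -/
def runFun {Q : Type*} (out : Q → Equiv.Perm X) (nxt : Q → X → Q) : Q → List X → List X
  | _, [] => []
  | q, a :: w => out q a :: runFun out nxt (nxt q a) w

/-- The inverse of `runFun`. -/
def runInv {Q : Type*} (out : Q → Equiv.Perm X) (nxt : Q → X → Q) : Q → List X → List X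
  | _, [] => []
  | q, a :: w => (out q).symm a :: runInv out nxt (nxt q ((out q).symm a)) w

section Automaton

variable {Q : Type*} (out : Q → Equiv.Perm X) (nxt : Q → X → Q)

theorem runInv_runFun (q : Q) (w : List X) : runInv out nxt q (runFun out nxt q w) = w := by
  induction w generalizing q with
  | nil => rfl
  | cons a w ih => simp [runFun, runInv, ih]

theorem runFun_runInv (q : Q) (w : List X) : runFun out nxt q (runInv out nxt q w) = w := by
  induction w generalizing q with
  | nil => rfl
  | cons a w ih => simp [runFun, runInv, ih]

theorem isChild_cons (a b : X) (u v : List X) :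
    IsChild (a :: u) (b :: v) ↔ a = b ∧ IsChild u v := by
  simp only [IsChild, List.cons_append, List.cons.injEq]
  constructor
  · rintro ⟨c, rfl, h⟩
    exact ⟨rfl, c, h⟩
  · rintro ⟨rfl, c, h⟩
    exact ⟨c, rfl, h⟩

theorem isChild_runFun (q : Q) (u v : List X) :
    IsChild (runFun out nxt q u) (runFun out nxt q v) ↔ IsChild u v := by
  induction u generalizing q v with
  | nil =>
    cases v with
    | nil => rfl
    | cons b v => cases v <;> simp [runFun, IsChild]
  | cons a u ih =>
    cases v with
    | nil => simp [runFun, IsChild]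
    | cons b v =>
      simp only [runFun, isChild_cons, EmbeddingLike.apply_eq_iff_eq]
      constructor
      · rintro ⟨rfl, h⟩
        exact ⟨rfl, (ih _ _).1 h⟩
      · rintro ⟨rfl, h⟩
        exact ⟨rfl, (ih _ _).2 h⟩

/-- The tree automorphism given by the state `q` of an automaton: the unique solution of the system
`q = (nxt q a)_{a ∈ X} (out q)`, `q ∈ Q` (see `hasDecomp_ofAutomaton`, `eq_ofAutomaton`). -/
def ofAutomaton (q : Q) : TreeAut X :=
  ⟨{ toFun := runFun out nxt q
     invFun := runInv out nxt q
     left_inv := runInv_runFun out nxt q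
     right_inv := runFun_runInv out nxt q },
   fun u v => isChild_runFun out nxt q u v⟩

theorem hasDecomp_ofAutomaton (q : Q) :
    HasDecomp (ofAutomaton out nxt q) (fun a => ofAutomaton out nxt (nxt q a)) (out q) := by
  refine ⟨Equiv.ext fun a => rfl, fun a => Subtype.ext (Equiv.ext fun w => rfl)⟩

theorem eq_ofAutomaton (f : Q → TreeAut X)
    (hf : ∀ q, HasDecomp (f q) (fun a => f (nxt q a)) (out q)) (q : Q) :
    f q = ofAutomaton out nxt q := by
  refine Subtype.ext (Equiv.ext fun w => ?_)
  induction w generalizing q with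
  | nil => rw [apply_nil, apply_nil]
  | cons a w ih =>
    rw [apply_cons, apply_cons, (hf q).1, (hf q).2 a, (hasDecomp_ofAutomaton out nxt q).1,
      (hasDecomp_ofAutomaton out nxt q).2 a, ih]

end Automaton

end TreeAut

/-! ### The Apollonian group -/

namespace Apollonian

open TreeAut

/-- The states: the identity and the three generators. -/
inductive State where
  | one | x | y | z

/-- The root permutations `()`, `(1 2)`, `(1 3)`, `(2 3)`; the letters 1, 2, 3 are `0 1 2 : Fin 3`. -/
def out : State → Equiv.Perm (Fin 3)
  | .one => 1
  | .x => Equiv.swap 0 1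
  | .y => Equiv.swap 0 2
  | .z => Equiv.swap 1 2

/-- The first-level sections `(1,1,1)`, `(1,y,1)`, `(x,1,1)`, `(1,1,z)`. -/
def nxt : State → Fin 3 → State
  | .one => ![.one, .one, .one]
  | .x => ![.one, .y, .one]
  | .y => ![.x, .one, .one]
  | .z => ![.one, .one, .z]

/-- The generator `x = (1,y,1)(1 2)`. -/
def x : TreeAut (Fin 3) := ofAutomaton out nxt .x

/-- The generator `y = (x,1,1)(1 3)`. -/
def y : TreeAut (Fin 3) := ofAutomaton out nxt .y

/-- The generator `z = (1,1,z)(2 3)`. -/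
def z : TreeAut (Fin 3) := ofAutomaton out nxt .z

theorem ofAutomaton_one : ofAutomaton out nxt .one = 1 := by
  have h : ∀ a, nxt .one a = .one := by
    intro a
    fin_cases a <;> rfl
  refine Subtype.ext (Equiv.ext fun w => ?_)
  change runFun out nxt .one w = w
  induction w with
  | nil => rfl
  | cons a w ih => rw [runFun, h, ih]; rfl

theorem x_decomp : HasDecomp x ![1, y, 1] (Equiv.swap 0 1) := by
  refine ⟨rfl, fun a => ?_⟩
  fin_cases a
  · exact ofAutomaton_one
  · rfl
  · exact ofAutomaton_one

theorem y_decomp : HasDecomp y ![x, 1, 1] (Equiv.swap 0 2) := by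
  refine ⟨rfl, fun a => ?_⟩
  fin_cases a
  · rfl
  · exact ofAutomaton_one
  · exact ofAutomaton_one

theorem z_decomp : HasDecomp z ![1, 1, z] (Equiv.swap 1 2) := by
  refine ⟨rfl, fun a => ?_⟩
  fin_cases a
  · exact ofAutomaton_one
  · exact ofAutomaton_one
  · rfl

/-- The Apollonian group `⟨x, y, z⟩`. -/
def group : Subgroup (TreeAut (Fin 3)) := Subgroup.closure {x, y, z}

end Apollonian

/-! The group is determined by one sign relation: an automorphism lies in it exactly when its
first-level sections do and the signs of their root permutations multiply to the sign of its own
root permutation (`group_le_signWreath`, `signWreath_le_group`). The relation is multiplicative, so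
its necessity is checked on generators.

For sufficiency, consider the subgroup `rigid` of those `g` with `(1, 1, g)` in the group. Explicit
words put `x * s` and `x * s⁻¹` in it for every generator `s`, so it has index at most two in the
group, and its elements are even. Conjugation moves it to the other two coordinates, and triples
with two odd entries are obtained from `y * y` and `x * x`. Hence all triples of group elements with
sign product 1 lie in the group. As the group acts on the first level as the full symmetric group,
sufficiency follows.

The nucleus consists of the identity, the generators and their inverses: sections at level two of a
product of two such elements are again of this kind, and each of them recurs as a section of itself.
So `a_0 = 7`. An element has depth at most `n + 1` iff its three sections have depth at most `n`;
these sections are arbitrary, and the sign relation then leaves three root permutations, so `a_{n+1}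
= 3 a_n ^ 3`. -/

namespace TreeAut

variable {X : Type*}

/-! ### The wreath recursion -/

theorem ext_apply {g h : TreeAut X} (H : ∀ w, g.1 w = h.1 w) : g = h :=
  Subtype.ext (Equiv.ext H)

/-- An automorphism is determined by its root permutation and its first-level sections. -/
theorem ext_decomp {g h : TreeAut X} (hr : rootPerm g = rootPerm h)
    (hs : ∀ a, sec g [a] = sec h [a]) : g = h := by
  refine ext_apply fun w => ?_
  cases w with
  | nil => rw [apply_nil, apply_nil]
  | cons a w => rw [apply_cons, apply_cons, hr, hs]

@[simp]
theorem sec_nil (g : TreeAut X) : sec g [] = g := by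
  refine ext_apply fun w => ?_
  have h := apply_append_sec g [] w
  rw [apply_nil] at h
  exact h.symm

theorem sec_append (g : TreeAut X) (u v : List X) : sec g (u ++ v) = sec (sec g u) v := by
  refine ext_apply fun w => ?_
  have h := apply_append_sec g (u ++ v) w
  rw [List.append_assoc, apply_append_sec, apply_append_sec, apply_append_sec,
    List.append_assoc] at h
  exact (List.append_cancel_left (List.append_cancel_left h)).symm

theorem sec_cons (g : TreeAut X) (a : X) (v : List X) :
    sec g (a :: v) = sec (sec g [a]) v :=
  sec_append g [a] v

theorem sec_mul (g h : TreeAut X) (u : List X) : sec (g * h) u = sec g (h.1 u) * sec h u := by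
  refine ext_apply fun w => ?_
  have h1 := apply_append_sec (g * h) u w
  change g.1 (h.1 (u ++ w)) = g.1 (h.1 u) ++ _ at h1
  rw [apply_append_sec, apply_append_sec] at h1
  exact (List.append_cancel_left h1).symm

@[simp]
theorem rootPerm_mul (g h : TreeAut X) : rootPerm (g * h) = rootPerm g * rootPerm h := by
  refine Equiv.ext fun a => ?_
  have h1 := apply_singleton (g * h) a
  change g.1 (h.1 [a]) = _ at h1
  rw [apply_singleton, apply_singleton] at h1
  exact (List.singleton_injective h1).symm

@[simp]
theorem rootPerm_one : rootPerm (1 : TreeAut X) = 1 := rfl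

@[simp]
theorem rootPerm_inv (g : TreeAut X) : rootPerm g⁻¹ = (rootPerm g)⁻¹ :=
  eq_inv_of_mul_eq_one_left (by rw [← rootPerm_mul, inv_mul_cancel, rootPerm_one])

@[simp]
theorem sec_one (u : List X) : sec (1 : TreeAut X) u = 1 :=
  ext_apply fun w => by
    have h := apply_append_sec (1 : TreeAut X) u w
    exact (List.append_cancel_left h).symm

-- With the rules for root permutations and inverses, this lets `simp` compute the decomposition of
-- any word in the generators.
@[simp]
theorem sec_mul_singleton (g h : TreeAut X) (a : X) :
    sec (g * h) [a] = sec g [rootPerm h a] * sec h [a] := by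
  rw [sec_mul, apply_singleton]

@[simp]
theorem sec_inv_singleton (g : TreeAut X) (a : X) :
    sec g⁻¹ [a] = (sec g [(rootPerm g)⁻¹ a])⁻¹ := by
  refine eq_inv_of_mul_eq_one_right ?_
  have h := sec_mul_singleton g g⁻¹ a
  rw [mul_inv_cancel, sec_one, rootPerm_inv] at h
  exact h.symm

/-- The map on words given by first-level sections `s` and root permutation `α`. -/
def consFun (s : X → List X → List X) (α : X → X) : List X → List X
  | [] => []
  | a :: w => α a :: s a w

/-- The automorphism `(s_a)_{a ∈ X} α`. -/
def ofDecomp (s : X → TreeAut X) (α : Equiv.Perm X) : TreeAut X :=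
  ⟨{ toFun := consFun (fun a => (s a).1) α
     invFun := consFun (fun a => (s (α.symm a)).1.symm) α.symm
     left_inv := fun w => by cases w <;> simp [consFun]
     right_inv := fun w => by cases w <;> simp [consFun] },
   fun u v => by
    change IsChild (consFun _ _ u) (consFun _ _ v) ↔ IsChild u v
    cases u with
    | nil =>
      cases v with
      | nil => rfl
      | cons b v =>
        have h : (s b).1 v = [] ↔ v = [] := by
          rw [← List.length_eq_zero_iff, length_apply, List.length_eq_zero_iff]
        simp [consFun, IsChild, h]
    | cons a u =>
      cases v with
      | nil => simp [consFun, IsChild]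
      | cons b v =>
        simp only [consFun, isChild_cons, EmbeddingLike.apply_eq_iff_eq]
        constructor
        · rintro ⟨rfl, h⟩
          exact ⟨rfl, (isChild_iff _ _ _).1 h⟩
        · rintro ⟨rfl, h⟩
          exact ⟨rfl, (isChild_iff _ _ _).2 h⟩⟩

@[simp]
theorem rootPerm_ofDecomp (s : X → TreeAut X) (α : Equiv.Perm X) :
    rootPerm (ofDecomp s α) = α := rfl

@[simp]
theorem sec_ofDecomp (s : X → TreeAut X) (α : Equiv.Perm X) (a : X) :
    sec (ofDecomp s α) [a] = s a :=
  ext_apply fun w => (List.cons.inj (apply_cons (ofDecomp s α) a w)).2.symm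

/-- A vertex whose section is the whole automorphism can be pushed to any depth. -/
theorem exists_le_length_sec_eq {g : TreeAut X} {v : List X} (hv : v ≠ [])
    (h : sec g v = g) (n : ℕ) : ∃ u : List X, n ≤ u.length ∧ sec g u = g := by
  induction n with
  | zero => exact ⟨[], le_rfl, sec_nil g⟩
  | succ n ih =>
    obtain ⟨u, hu, hs⟩ := ih
    refine ⟨v ++ u, ?_, by rw [sec_append, h, hs]⟩
    have := List.length_pos_iff.2 hv
    rw [List.length_append]
    omega

/-- A section that recurs at arbitrarily deep vertices belongs to every contracting set. -/
theorem mem_nucleus_of_sec_eq {G : Subgroup (TreeAut X)} {g : TreeAut X} (hg : g ∈ G)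
    {v : List X} (hv : v ≠ []) (h : sec g v = g) : g ∈ nucleus G := by
  rintro M ⟨-, -, hM⟩
  obtain ⟨n, hn⟩ := hM g hg
  obtain ⟨u, hu, hs⟩ := exists_le_length_sec_eq hv h n
  exact hs ▸ hn u hu

theorem isSelfSimilar_of_singleton {G : Subgroup (TreeAut X)}
    (h : ∀ g ∈ G, ∀ a, sec g [a] ∈ G) : IsSelfSimilar G := by
  intro g hg u
  induction u generalizing g with
  | nil => rwa [sec_nil]
  | cons a u ih => rw [sec_cons]; exact ih _ (h g hg a)

/-! ### Automorphisms of bounded depth -/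

theorem depthLE_zero [Fintype X] {G : Subgroup (TreeAut X)} (hG : nucleus G ⊆ G) :
    depthLE G 0 = nucleus G := by
  ext g
  constructor
  · rintro ⟨-, P, hP, hd⟩
    cases P with
    | leaf h => exact hP.1
    | node α c => simp [Portrait.depth] at hd
  · exact fun hg => ⟨hG hg, .leaf g, ⟨hg, rfl⟩, le_rfl⟩

/-- If the nucleus is closed under sections, the depth of an element is at most `n + 1` if and only
if the depths of its first-level sections are at most `n`. -/
theorem mem_depthLE_succ [Fintype X] {G : Subgroup (TreeAut X)} (hG : IsSelfSimilar G)
    (hN : ∀ g ∈ nucleus G, ∀ a, sec g [a] ∈ nucleus G) {n : ℕ} {g : TreeAut X} :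
    g ∈ depthLE G (n + 1) ↔ g ∈ G ∧ ∀ a, sec g [a] ∈ depthLE G n := by
  constructor
  · rintro ⟨hg, P, hP, hd⟩
    refine ⟨hg, fun a => ⟨hG g hg [a], ?_⟩⟩
    cases P with
    -- A nucleus element has no subtrees to pass on; closure of the nucleus under sections gives
    -- each section a one-vertex portrait.
    | leaf h => exact ⟨.leaf _, ⟨hN g hP.1 a, rfl⟩, Nat.zero_le _⟩
    | node α c =>
      refine ⟨c a, hP.2.2 a, ?_⟩
      simp only [Portrait.depth, Nat.add_le_add_iff_right] at hd
      exact (Finset.le_sup (f := fun a => (c a).depth) (Finset.mem_univ a)).trans hd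
  · rintro ⟨hg, h⟩
    refine ⟨hg, ?_⟩
    by_cases hgN : g ∈ nucleus G
    · exact ⟨.leaf g, ⟨hgN, rfl⟩, Nat.zero_le _⟩
    · choose _ c hc hd using h
      refine ⟨.node (rootPerm g) c, ⟨hgN, rfl, hc⟩, ?_⟩
      simp only [Portrait.depth, Nat.add_le_add_iff_right]
      exact Finset.sup_le fun a _ => hd a

/-! ### The sign relation -/

variable [Fintype X] [DecidableEq X]

/-- The product of the signs of the root permutations of a family of automorphisms. -/
def signProd (s : X → TreeAut X) : ℤˣ := ∏ a, Equiv.Perm.sign (rootPerm (s a))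

/-- The automorphisms whose first-level sections are in `G`, and for which the signs of the root
permutations of these sections multiply to the sign of the root permutation. -/
def signWreath (G : Subgroup (TreeAut X)) : Subgroup (TreeAut X) where
  carrier := {g | (∀ a, sec g [a] ∈ G) ∧
    signProd (fun a => sec g [a]) = Equiv.Perm.sign (rootPerm g)}
  one_mem' := by simp [signProd, G.one_mem]
  mul_mem' := by
    rintro g h ⟨hg, hg'⟩ ⟨hh, hh'⟩
    refine ⟨fun a => ?_, ?_⟩
    · rw [sec_mul_singleton]
      exact G.mul_mem (hg _) (hh _)
    · rw [rootPerm_mul, map_mul, ← hg', ← hh']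
      simp only [signProd, sec_mul_singleton, rootPerm_mul, map_mul, Finset.prod_mul_distrib]
      congr 1
      -- The root permutation of `h` only reorders the factors coming from `g`.
      exact Equiv.prod_comp (rootPerm h) fun a => Equiv.Perm.sign (rootPerm (sec g [a]))
  inv_mem' := by
    rintro g ⟨hg, hg'⟩
    refine ⟨fun a => ?_, ?_⟩
    · rw [sec_inv_singleton]
      exact G.inv_mem (hg _)
    · rw [rootPerm_inv, map_inv, ← hg']
      simp only [signProd, sec_inv_singleton, rootPerm_inv, map_inv, Finset.prod_inv_distrib]
      congr 1
      exact Equiv.prod_comp (rootPerm g)⁻¹ fun a => Equiv.Perm.sign (rootPerm (sec g [a]))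

theorem mem_signWreath {G : Subgroup (TreeAut X)} {g : TreeAut X} :
    g ∈ signWreath G ↔ (∀ a, sec g [a] ∈ G) ∧
      signProd (fun a => sec g [a]) = Equiv.Perm.sign (rootPerm g) := Iff.rfl

/-- The automorphisms with sections in `S` that satisfy the sign relation: the sections are
arbitrary, and for given sections the root permutations are a coset of the alternating group. -/
theorem card_sign_relation [Nontrivial X] (S : Set (TreeAut X)) :
    {g : TreeAut X | (∀ a, sec g [a] ∈ S) ∧
      signProd (fun a => sec g [a]) = Equiv.Perm.sign (rootPerm g)}.ncard =
    S.ncard ^ Fintype.card X * Nat.card (alternatingGroup X) := by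
  -- `c ε` is a fixed permutation of sign `ε`; right multiplication by it identifies the alternating
  -- group with the permutations of sign `ε`.
  choose c hc using Equiv.Perm.sign_surjective X
  rw [← Nat.card_coe_set_eq S, ← Nat.card_eq_fintype_card, ← Nat.card_fun, ← Nat.card_prod,
    ← Nat.card_coe_set_eq]
  refine Nat.card_congr
    { toFun := fun g => (fun a => ⟨sec g.1 [a], g.2.1 a⟩,
        ⟨rootPerm g.1 * (c (signProd fun a => sec g.1 [a]))⁻¹, ?_⟩)
      invFun := fun p => ⟨ofDecomp (fun a => (p.1 a).1)
        (p.2.1 * c (signProd fun a => (p.1 a).1)), fun a => by simp, ?_⟩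
      left_inv := fun g => ?_
      right_inv := fun p => ?_ }
  · rw [Equiv.Perm.mem_alternatingGroup, map_mul, map_inv, hc, g.2.2, mul_inv_cancel]
  · have h := Equiv.Perm.mem_alternatingGroup.1 p.2.2
    simp [hc, h]
  · exact Subtype.ext (ext_decomp (by simp) (by simp))
  · refine Prod.ext (funext fun a => Subtype.ext ?_) (Subtype.ext ?_) <;> simp

end TreeAut

/-! ### Decompositions of the generators. -/

namespace Apollonian

open TreeAut

theorem x_mem : x ∈ group := Subgroup.subset_closure (by simp)

theorem y_mem : y ∈ group := Subgroup.subset_closure (by simp)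

theorem z_mem : z ∈ group := Subgroup.subset_closure (by simp)

@[simp] theorem rootPerm_x : rootPerm x = Equiv.swap 0 1 := rfl
@[simp] theorem rootPerm_y : rootPerm y = Equiv.swap 0 2 := rfl
@[simp] theorem rootPerm_z : rootPerm z = Equiv.swap 1 2 := rfl

@[simp] theorem sec_x_zero : sec x [0] = 1 := x_decomp.2 0
@[simp] theorem sec_x_one : sec x [1] = y := x_decomp.2 1
@[simp] theorem sec_x_two : sec x [2] = 1 := x_decomp.2 2
@[simp] theorem sec_y_zero : sec y [0] = x := y_decomp.2 0
@[simp] theorem sec_y_one : sec y [1] = 1 := y_decomp.2 1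
@[simp] theorem sec_y_two : sec y [2] = 1 := y_decomp.2 2
@[simp] theorem sec_z_zero : sec z [0] = 1 := z_decomp.2 0
@[simp] theorem sec_z_one : sec z [1] = 1 := z_decomp.2 1
@[simp] theorem sec_z_two : sec z [2] = z := z_decomp.2 2

theorem swap_zero_one_two : Equiv.swap (0 : Fin 3) 1 2 = 2 := by decide
theorem swap_zero_two_one : Equiv.swap (0 : Fin 3) 2 1 = 1 := by decide
theorem swap_one_two_zero : Equiv.swap (1 : Fin 3) 2 0 = 0 := by decide

attribute [simp] swap_zero_one_two swap_zero_two_one swap_one_two_zero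

/-! ### The group satisfies the sign relation -/

/-- `signWreath group` is a subgroup, so generators suffice. Each is odd at the root and has exactly
one nontrivial section, again a generator and hence odd. -/
theorem group_le_signWreath : group ≤ signWreath group := by
  refine (Subgroup.closure_le _).2 ?_
  rintro g (rfl | rfl | rfl) <;> refine mem_signWreath.2 ⟨fun a => ?_, ?_⟩
  all_goals first
    | (fin_cases a <;> simp [group.one_mem, x_mem, y_mem, z_mem])
    | (simp [signProd, Fin.prod_univ_three, Equiv.Perm.sign_swap'])

theorem sec_mem {g : TreeAut (Fin 3)} (hg : g ∈ group) (a : Fin 3) : sec g [a] ∈ group :=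
  (group_le_signWreath hg).1 a

theorem isSelfSimilar_group : IsSelfSimilar group :=
  isSelfSimilar_of_singleton fun _ hg a => sec_mem hg a

/-! ### The sign relation characterizes the group -/

/-- The automorphism `(g, h, k)` fixing the first level. -/
def triple (g h k : TreeAut (Fin 3)) : TreeAut (Fin 3) := ofDecomp ![g, h, k] 1

@[simp] theorem rootPerm_triple (g h k) : rootPerm (triple g h k) = 1 := rfl
@[simp] theorem sec_triple_zero (g h k) : sec (triple g h k) [0] = g := sec_ofDecomp _ _ _
@[simp] theorem sec_triple_one (g h k) : sec (triple g h k) [1] = h := sec_ofDecomp _ _ _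
@[simp] theorem sec_triple_two (g h k) : sec (triple g h k) [2] = k := sec_ofDecomp _ _ _

theorem triple_mul (g h k g' h' k') :
    triple g h k * triple g' h' k' = triple (g * g') (h * h') (k * k') := by
  refine ext_decomp (by simp) fun a => ?_
  fin_cases a <;> simp

theorem triple_inv (g h k) : (triple g h k)⁻¹ = triple g⁻¹ h⁻¹ k⁻¹ := by
  refine ext_decomp (by simp) fun a => ?_
  fin_cases a <;> simp

/-- The automorphisms that are sections at the third vertex of elements of the group whose other
first-level sections and root permutation are trivial. -/
def rigid : Subgroup (TreeAut (Fin 3)) where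
  carrier := {g | triple 1 1 g ∈ group}
  one_mem' := by
    have h : triple 1 1 1 = 1 := by
      refine ext_decomp rfl fun a => ?_
      fin_cases a <;> simp
    change triple 1 1 1 ∈ group
    rw [h]
    exact group.one_mem
  mul_mem' := fun {g h} hg hh => by
    have := group.mul_mem hg hh
    rwa [triple_mul, one_mul] at this
  inv_mem' := fun {g} hg => by
    have := group.inv_mem hg
    rwa [triple_inv, inv_one] at this

theorem triple_third {g : TreeAut (Fin 3)} (hg : g ∈ rigid) : triple 1 1 g ∈ group := hg

/-- `y` carries the third vertex to the first with trivial section there, so conjugation by it moves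
`g` unchanged. -/
theorem triple_first {g : TreeAut (Fin 3)} (hg : g ∈ rigid) : triple g 1 1 ∈ group := by
  have h : triple g 1 1 = y * triple 1 1 g * y⁻¹ := by
    refine ext_decomp (by simp) fun a => ?_
    fin_cases a <;> simp
  rw [h]
  exact group.mul_mem (group.mul_mem y_mem (triple_third hg)) (group.inv_mem y_mem)

theorem triple_second {g : TreeAut (Fin 3)} (hg : g ∈ rigid) : triple 1 g 1 ∈ group := by
  have h : triple 1 g 1 = z⁻¹ * triple 1 1 g * z := by
    refine ext_decomp (by simp) fun a => ?_
    fin_cases a <;> simp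
  rw [h]
  exact group.mul_mem (group.mul_mem (group.inv_mem z_mem) (triple_third hg)) z_mem

theorem triple_rigid {g h k : TreeAut (Fin 3)} (hg : g ∈ rigid) (hh : h ∈ rigid)
    (hk : k ∈ rigid) : triple g h k ∈ group := by
  have := group.mul_mem (group.mul_mem (triple_first hg) (triple_second hh)) (triple_third hk)
  simpa only [triple_mul, one_mul, mul_one] using this

theorem mem_rigid_of_eq {g w : TreeAut (Fin 3)} (h0 : sec w [0] = 1) (h1 : sec w [1] = 1)
    (h2 : sec w [2] = g) (hr : rootPerm w = 1) (hw : w ∈ group) : g ∈ rigid := by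
  have h : triple 1 1 g = w := by
    refine ext_decomp (by simp [hr]) fun a => ?_
    fin_cases a <;> simp [h0, h1, h2]
  change triple 1 1 g ∈ group
  rwa [h]

/-- Here and in the next four lemmas, `w` is a word in the generators that evaluates to the triple
with the required element in third place. -/
theorem x_mul_x_mem_rigid : x * x ∈ rigid := by
  refine mem_rigid_of_eq (w := x * y * x⁻¹ * y⁻¹ * z⁻¹ * y * z * y) (by simp) (by simp)
    (by simp) (by rw [Equiv.ext_iff]; simp [Fin.forall_fin_succ]) ?_
  repeat' first
    | with_reducible exact x_mem
    | with_reducible exact y_mem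
    | with_reducible exact z_mem
    | apply group.inv_mem
    | apply group.mul_mem

theorem x_mul_y_mem_rigid : x * y ∈ rigid := by
  refine mem_rigid_of_eq (w := y * z * x * z⁻¹) (by simp) (by simp)
    (by simp) (by rw [Equiv.ext_iff]; simp [Fin.forall_fin_succ]) ?_
  repeat' first
    | with_reducible exact x_mem
    | with_reducible exact y_mem
    | with_reducible exact z_mem
    | apply group.inv_mem
    | apply group.mul_mem

theorem x_mul_z_mem_rigid : x * z ∈ rigid := by
  refine mem_rigid_of_eq (w := x * y * x⁻¹ * z) (by simp) (by simp)
    (by simp) (by rw [Equiv.ext_iff]; simp [Fin.forall_fin_succ]) ?_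
  repeat' first
    | with_reducible exact x_mem
    | with_reducible exact y_mem
    | with_reducible exact z_mem
    | apply group.inv_mem
    | apply group.mul_mem

theorem x_mul_y_inv_mem_rigid : x * y⁻¹ ∈ rigid := by
  refine mem_rigid_of_eq (w := x * y * x⁻¹ * y⁻¹ * x⁻¹ * y) (by simp) (by simp)
    (by simp) (by rw [Equiv.ext_iff]; simp [Fin.forall_fin_succ]) ?_
  repeat' first
    | with_reducible exact x_mem
    | with_reducible exact y_mem
    | with_reducible exact z_mem
    | apply group.inv_mem
    | apply group.mul_mem

theorem x_mul_z_inv_mem_rigid : x * z⁻¹ ∈ rigid := by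
  refine mem_rigid_of_eq (w := y * z * y * z⁻¹ * y⁻¹ * z⁻¹) (by simp) (by simp)
    (by simp) (by rw [Equiv.ext_iff]; simp [Fin.forall_fin_succ]) ?_
  repeat' first
    | with_reducible exact x_mem
    | with_reducible exact y_mem
    | with_reducible exact z_mem
    | apply group.inv_mem
    | apply group.mul_mem

theorem x_mul_generator_mem_rigid {s : TreeAut (Fin 3)} (hs : s ∈ ({x, y, z} : Set _)) :
    x * s ∈ rigid ∧ x * s⁻¹ ∈ rigid := by
  rcases hs with rfl | rfl | rfl
  · exact ⟨x_mul_x_mem_rigid, by rw [mul_inv_cancel]; exact rigid.one_mem⟩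
  · exact ⟨x_mul_y_mem_rigid, x_mul_y_inv_mem_rigid⟩
  · exact ⟨x_mul_z_mem_rigid, x_mul_z_inv_mem_rigid⟩

/-- The rigid stabilizer has index at most two. -/
theorem mem_rigid_or {g : TreeAut (Fin 3)} (hg : g ∈ group) :
    g ∈ rigid ∨ g * x⁻¹ ∈ rigid := by
  induction hg using Subgroup.closure_induction_right with
  | one => exact Or.inl rigid.one_mem
  | mul_right g _ s hs ih =>
    obtain ⟨h1, h2⟩ := x_mul_generator_mem_rigid hs
    rcases ih with h | h
    · refine Or.inr ?_
      -- `g s x⁻¹ = g (x s⁻¹)⁻¹`; in the other coset, `g s = (g x⁻¹)(x s)`.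
      have := rigid.mul_mem h (rigid.inv_mem h2)
      simpa [mul_assoc] using this
    · refine Or.inl ?_
      have := rigid.mul_mem h h1
      simpa [mul_assoc] using this
  | mul_inv_cancel g _ s hs ih =>
    obtain ⟨h1, h2⟩ := x_mul_generator_mem_rigid hs
    rcases ih with h | h
    · refine Or.inr ?_
      have := rigid.mul_mem h (rigid.inv_mem h1)
      simpa [mul_assoc] using this
    · refine Or.inl ?_
      have := rigid.mul_mem h h2
      simpa [mul_assoc] using this

theorem sign_of_mem_rigid {g : TreeAut (Fin 3)} (hg : g ∈ rigid) :
    Equiv.Perm.sign (rootPerm g) = 1 := by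
  have h := (group_le_signWreath (triple_third hg)).2
  simpa [signProd, Fin.prod_univ_three] using h

theorem exists_rigid_mul {g : TreeAut (Fin 3)} (hg : g ∈ group) :
    ∃ n ∈ rigid, (g = n ∧ Equiv.Perm.sign (rootPerm g) = 1) ∨
      (g = n * x ∧ Equiv.Perm.sign (rootPerm g) = -1) := by
  rcases mem_rigid_or hg with h | h
  · exact ⟨g, h, Or.inl ⟨rfl, sign_of_mem_rigid h⟩⟩
  · refine ⟨g * x⁻¹, h, Or.inr ⟨by group, ?_⟩⟩
    have := sign_of_mem_rigid h
    simp only [rootPerm_mul, rootPerm_inv, rootPerm_x, map_mul, map_inv] at this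
    rw [Equiv.Perm.sign_swap (by decide)] at this
    simpa [neg_eq_iff_eq_neg] using this

theorem triple_x_one_x : triple x 1 x ∈ group := by
  have h : triple x 1 x = y * y := by
    refine ext_decomp (by simp) fun a => ?_
    fin_cases a <;> simp
  rw [h]
  exact group.mul_mem y_mem y_mem

/-- `x * x` is `(y, y, 1)`, and `x` differs from `y` by the rigid factor `x * y⁻¹`. -/
theorem triple_x_x_one : triple x x 1 ∈ group := by
  have h : triple x x 1 = triple (x * y⁻¹) (x * y⁻¹) 1 * (x * x) := by
    refine ext_decomp (by simp) fun a => ?_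
    fin_cases a <;> simp
  rw [h]
  exact group.mul_mem (triple_rigid x_mul_y_inv_mem_rigid x_mul_y_inv_mem_rigid rigid.one_mem)
    (group.mul_mem x_mem x_mem)

theorem triple_one_x_x : triple 1 x x ∈ group := by
  have h : triple 1 x x = triple (x * x)⁻¹ 1 1 * (triple x x 1 * triple x 1 x) := by
    simp [triple_mul]
  rw [h]
  exact group.mul_mem (triple_first (rigid.inv_mem x_mul_x_mem_rigid))
    (group.mul_mem triple_x_x_one triple_x_one_x)

theorem triple_mem {g h k : TreeAut (Fin 3)} (hg : g ∈ group) (hh : h ∈ group)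
    (hk : k ∈ group) (hs : Equiv.Perm.sign (rootPerm g) * Equiv.Perm.sign (rootPerm h) *
      Equiv.Perm.sign (rootPerm k) = 1) : triple g h k ∈ group := by
  obtain ⟨a, ha, hga⟩ := exists_rigid_mul hg
  obtain ⟨b, hb, hhb⟩ := exists_rigid_mul hh
  obtain ⟨c, hc, hkc⟩ := exists_rigid_mul hk
  have habc := triple_rigid ha hb hc
  -- Of the eight sign patterns, those with an odd number of odd entries contradict `hs`. In the
  -- others the rigid parts form a triple, multiplied when needed by one of the three triples with
  -- two entries `x`.
  rcases hga with ⟨rfl, h1⟩ | ⟨rfl, h1⟩ <;> rcases hhb with ⟨rfl, h2⟩ | ⟨rfl, h2⟩ <;>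
    rcases hkc with ⟨rfl, h3⟩ | ⟨rfl, h3⟩ <;> rw [h1, h2, h3] at hs
  · exact habc
  · exact absurd hs (by decide)
  · exact absurd hs (by decide)
  · simpa [triple_mul] using group.mul_mem habc triple_one_x_x
  · exact absurd hs (by decide)
  · simpa [triple_mul] using group.mul_mem habc triple_x_one_x
  · simpa [triple_mul] using group.mul_mem habc triple_x_x_one
  · exact absurd hs (by decide)

theorem exists_rootPerm_eq (α : Equiv.Perm (Fin 3)) : ∃ g ∈ group, rootPerm g = α := by
  have h : ∀ α : Equiv.Perm (Fin 3), α = 1 ∨ α = Equiv.swap 0 1 ∨ α = Equiv.swap 0 2 ∨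
      α = Equiv.swap 1 2 ∨ α = Equiv.swap 0 1 * Equiv.swap 0 2 ∨
      α = Equiv.swap 0 2 * Equiv.swap 0 1 := by decide
  rcases h α with rfl | rfl | rfl | rfl | rfl | rfl
  · exact ⟨1, group.one_mem, rfl⟩
  · exact ⟨x, x_mem, rfl⟩
  · exact ⟨y, y_mem, rfl⟩
  · exact ⟨z, z_mem, rfl⟩
  · exact ⟨x * y, group.mul_mem x_mem y_mem, by simp⟩
  · exact ⟨y * x, group.mul_mem y_mem x_mem, by simp⟩

theorem signWreath_le_group : signWreath group ≤ group := by
  intro g hg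
  obtain ⟨h, hh, hr⟩ := exists_rootPerm_eq (rootPerm g)
  -- Dividing by an element of the group with the same root permutation reduces to automorphisms
  -- fixing the first level.
  have hk := (signWreath group).mul_mem hg ((signWreath group).inv_mem (group_le_signWreath hh))
  have hk1 : rootPerm (g * h⁻¹) = 1 := by rw [rootPerm_mul, rootPerm_inv, hr, mul_inv_cancel]
  generalize hkdef : g * h⁻¹ = k at hk hk1
  have hk' : k = triple (sec k [0]) (sec k [1]) (sec k [2]) := by
    refine ext_decomp hk1 fun a => ?_
    fin_cases a <;> simp
  have hkm : k ∈ group := by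
    rw [hk']
    refine triple_mem (hk.1 0) (hk.1 1) (hk.1 2) ?_
    have := hk.2
    rwa [hk1, signProd, Fin.prod_univ_three, map_one] at this
  have := group.mul_mem hkm hh
  rwa [← hkdef, inv_mul_cancel_right] at this

/-! ### The nucleus -/

/-- The set `{1, x, y, z, x⁻¹, y⁻¹, z⁻¹}`. -/
def core : Set (TreeAut (Fin 3)) := {1, x, y, z, x⁻¹, y⁻¹, z⁻¹}

theorem core_subset : core ⊆ group := by
  rintro g (rfl | rfl | rfl | rfl | rfl | rfl | rfl) <;>
    simp [group.one_mem, x_mem, y_mem, z_mem]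

theorem sec_core {g : TreeAut (Fin 3)} (hg : g ∈ core) (a : Fin 3) : sec g [a] ∈ core := by
  rcases hg with rfl | rfl | rfl | rfl | rfl | rfl | rfl <;> fin_cases a <;> simp [core]

theorem sec_core_word {g : TreeAut (Fin 3)} (hg : g ∈ core) (u : List (Fin 3)) :
    sec g u ∈ core := by
  induction u generalizing g with
  | nil => rwa [sec_nil]
  | cons a u ih => rw [sec_cons]; exact ih (sec_core hg a)

/-- The products of two elements of `core` that are first-level sections of such products. -/
def corePair : Set (TreeAut (Fin 3)) :=
  core ∪ {x * y, y * z, z * x, y⁻¹ * x⁻¹, z⁻¹ * y⁻¹, x⁻¹ * z⁻¹}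

theorem sec_corePair {g : TreeAut (Fin 3)} (hg : g ∈ corePair) (a : Fin 3) :
    sec g [a] ∈ core := by
  rcases hg with hg | rfl | rfl | rfl | rfl | rfl | rfl
  · exact sec_core hg a
  all_goals fin_cases a <;> simp [core]

theorem mem_core_iff {g : TreeAut (Fin 3)} :
    g ∈ core ↔ g = 1 ∨ g = x ∨ g = y ∨ g = z ∨ g = x⁻¹ ∨ g = y⁻¹ ∨ g = z⁻¹ := Iff.rfl

theorem mem_corePair_iff {g : TreeAut (Fin 3)} :
    g ∈ corePair ↔ g ∈ core ∨ g = x * y ∨ g = y * z ∨ g = z * x ∨ g = y⁻¹ * x⁻¹ ∨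
      g = z⁻¹ * y⁻¹ ∨ g = x⁻¹ * z⁻¹ := Iff.rfl

theorem sec_mul_core {g h : TreeAut (Fin 3)} (hg : g ∈ core) (hh : h ∈ core) (a : Fin 3) :
    sec (g * h) [a] ∈ corePair := by
  rw [sec_mul_singleton, mem_corePair_iff, mem_core_iff]
  rcases hg with rfl | rfl | rfl | rfl | rfl | rfl | rfl
  all_goals rcases hh with rfl | rfl | rfl | rfl | rfl | rfl | rfl
  all_goals fin_cases a
  all_goals simp

/-- One level brings the product into `corePair`, the second into `core`, which is closed under
sections. -/
theorem sec_mul_core_word {g h : TreeAut (Fin 3)} (hg : g ∈ core) (hh : h ∈ core)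
    {u : List (Fin 3)} (hu : 2 ≤ u.length) : sec (g * h) u ∈ core := by
  obtain _ | ⟨a, _ | ⟨b, u⟩⟩ := u
  · simp at hu
  · simp at hu
  · rw [sec_cons, sec_cons]
    exact sec_core_word (sec_corePair (sec_mul_core hg hh a) b) u

theorem exists_sec_mem_core {g : TreeAut (Fin 3)} (hg : g ∈ group) :
    ∃ n : ℕ, ∀ u : List (Fin 3), n ≤ u.length → sec g u ∈ core := by
  have step : ∀ g s : TreeAut (Fin 3), s ∈ core →
      (∃ n : ℕ, ∀ u : List (Fin 3), n ≤ u.length → sec g u ∈ core) →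
      ∃ n : ℕ, ∀ u : List (Fin 3), n ≤ u.length → sec (g * s) u ∈ core := by
    rintro g s hs ⟨n, hn⟩
    refine ⟨n + 2, fun u hu => ?_⟩
    -- After `n` letters the section of `g * s` is a product of two elements of `core`; the two
    -- remaining levels absorb it. The section of `g` is taken at the image under `s`, which has the
    -- same length `n`.
    rw [← List.take_append_drop n u, sec_append, sec_mul]
    have hl : (u.take n).length = n := by rw [List.length_take]; omega
    refine sec_mul_core_word (hn _ ?_) (sec_core_word hs _) ?_
    · rw [length_apply, hl]
    · rw [List.length_drop]; omega
  induction hg using Subgroup.closure_induction_right with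
  | one => exact ⟨0, fun u _ => by simp [core]⟩
  | mul_right g _ s hs ih =>
    exact step g s (by rcases hs with rfl | rfl | rfl <;> simp [core]) ih
  | mul_inv_cancel g _ s hs ih =>
    exact step g s⁻¹ (by rcases hs with rfl | rfl | rfl <;> simp [core]) ih

theorem isContractingSet_core : IsContractingSet group core :=
  ⟨by simp [core], core_subset, fun _ hg => exists_sec_mem_core hg⟩

theorem isContracting_group : IsContracting group :=
  ⟨isSelfSimilar_group, core, isContractingSet_core⟩

theorem nucleus_group : nucleus group = core := by
  refine (Set.sInter_subset_of_mem isContractingSet_core).antisymm fun g hg => ?_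
  -- `x` and `y` are sections of each other, so they return after two letters; `z` returns after
  -- one. The inverses do the same at the image vertices.
  have key : ∃ v : List (Fin 3), v ≠ [] ∧ sec g v = g := by
    rcases hg with rfl | rfl | rfl | rfl | rfl | rfl | rfl
    · exact ⟨[0], by simp, by simp⟩
    · exact ⟨[1, 0], by simp, by rw [sec_cons]; simp⟩
    · exact ⟨[0, 1], by simp, by rw [sec_cons]; simp⟩
    · exact ⟨[2], by simp, by simp⟩
    · exact ⟨[0, 2], by simp, by rw [sec_cons]; simp⟩
    · exact ⟨[2, 0], by simp, by rw [sec_cons]; simp⟩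
    · exact ⟨[1], by simp, by simp⟩
  obtain ⟨v, hv, h⟩ := key
  exact mem_nucleus_of_sec_eq (core_subset hg) hv h

theorem mul_self_ne_one : x * x ≠ 1 ∧ y * y ≠ 1 ∧ z * z ≠ 1 := by
  have hx : rootPerm x ≠ 1 := by rw [rootPerm_x]; decide
  have hy : rootPerm y ≠ 1 := by rw [rootPerm_y]; decide
  have hz : rootPerm z ≠ 1 := by rw [rootPerm_z]; decide
  refine ⟨fun h => hy ?_, fun h => hx ?_, fun h => hz ?_⟩
  · simpa using congrArg (fun g => rootPerm (sec g [0])) h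
  · simpa using congrArg (fun g => rootPerm (sec g [0])) h
  · simpa using congrArg (fun g => rootPerm (sec g [1])) h

/-- Root permutations separate all pairs except a generator and its inverse; these differ because no
generator is an involution. -/
theorem ncard_core : core.ncard = 7 := by
  obtain ⟨hx, hy, hz⟩ := mul_self_ne_one
  have key : ∀ {g h : TreeAut (Fin 3)}, rootPerm g ≠ rootPerm h → g ≠ h :=
    fun h e => h (congrArg rootPerm e)
  have hl : [1, x, y, z, x⁻¹, y⁻¹, z⁻¹].Nodup := by
    have ex : x ≠ x⁻¹ := fun h => hx (mul_eq_one_iff_eq_inv.2 h)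
    have ey : y ≠ y⁻¹ := fun h => hy (mul_eq_one_iff_eq_inv.2 h)
    have ez : z ≠ z⁻¹ := fun h => hz (mul_eq_one_iff_eq_inv.2 h)
    simp only [List.nodup_cons, List.mem_cons, List.not_mem_nil, not_or, or_false,
      not_false_eq_true, List.nodup_nil, and_true]
    refine ⟨⟨?_, ?_, ?_, ?_, ?_, ?_⟩, ⟨?_, ?_, ex, ?_, ?_⟩, ⟨?_, ?_, ey, ?_⟩, ⟨?_, ?_, ez⟩,
      ⟨?_, ?_⟩, ?_⟩ <;> refine key ?_ <;>
      simp only [rootPerm_one, rootPerm_inv, rootPerm_x, rootPerm_y, rootPerm_z] <;> decide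
  classical
  have h : core = ([1, x, y, z, x⁻¹, y⁻¹, z⁻¹].toFinset : Set (TreeAut (Fin 3))) := by
    ext g
    simp [core]
  rw [h, Set.ncard_coe_finset, List.toFinset_card_of_nodup hl]
  rfl

/-! ### The portrait growth -/

theorem portraitGrowth_zero : portraitGrowth group 0 = 7 := by
  rw [portraitGrowth, depthLE_zero (nucleus_group ▸ core_subset), nucleus_group, ncard_core]

/-- Both inclusions of the sign characterization enter here: membership in the group imposes nothing
beyond the sections and the sign. -/
theorem depthLE_succ (n : ℕ) : depthLE group (n + 1) =
    {g | (∀ a, sec g [a] ∈ depthLE group n) ∧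
      signProd (fun a => sec g [a]) = Equiv.Perm.sign (rootPerm g)} := by
  ext g
  rw [mem_depthLE_succ isSelfSimilar_group
    (by rw [nucleus_group]; exact fun _ hg a => sec_core hg a)]
  constructor
  · exact fun ⟨hg, h⟩ => ⟨h, (group_le_signWreath hg).2⟩
  · exact fun ⟨h, hs⟩ => ⟨signWreath_le_group ⟨fun a => (h a).1, hs⟩, h⟩

theorem portraitGrowth_succ (n : ℕ) :
    portraitGrowth group (n + 1) = 3 * portraitGrowth group n ^ 3 := by
  have h : Nat.card (alternatingGroup (Fin 3)) = 3 := by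
    rw [nat_card_alternatingGroup, Nat.card_fin]
    rfl
  rw [portraitGrowth, depthLE_succ, card_sign_relation, h, Fintype.card_fin, mul_comm,
    portraitGrowth]

theorem portraitGrowth_eq (n : ℕ) :
    portraitGrowth group n = 3 ^ ((3 ^ n - 1) / 2) * 7 ^ (3 ^ n) := by
  induction n with
  | zero => simp [portraitGrowth_zero]
  | succ n ih =>
    -- Since `3 ^ n = 2 * k + 1`, the truncated subtraction and division are exact, and the exponent
    -- passes from `k` to `3 * k + 1`.
    obtain ⟨k, hk⟩ : Odd (3 ^ n) := Odd.pow (by decide)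
    have h1 : (3 ^ n - 1) / 2 = k := by omega
    have h2 : (3 ^ (n + 1) - 1) / 2 = 3 * k + 1 := by rw [pow_succ]; omega
    rw [portraitGrowth_succ, ih, h1, h2, pow_succ 3 n]
    ring

end Apollonian

/-! ### The closed form over the reals. -/

theorem three_pow_mul_seven_pow_eq (n : ℕ) :
    (3 : ℝ) ^ ((3 ^ n - 1) / 2) * 7 ^ (3 ^ n) = 1 / √3 * (7 * √3) ^ (3 ^ n) := by
  obtain ⟨k, hk⟩ : Odd (3 ^ n) := Odd.pow (by decide)
  have h1 : (3 ^ n - 1) / 2 = k := by omega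
  have h3 : √(3 : ℝ) ≠ 0 := by positivity
  -- `√3 ^ (2 * k + 1) = 3 ^ k * √3`, and the last factor cancels `1 / √3`.
  rw [h1, hk, mul_pow, pow_succ √3, pow_mul √3, Real.sq_sqrt (by norm_num)]
  field_simp

theorem mainTheorem4 :
    TreeAut.IsContracting Apollonian.group ∧
      ∀ n : ℕ,
        TreeAut.portraitGrowth Apollonian.group n = 3 ^ ((3 ^ n - 1) / 2) * 7 ^ (3 ^ n) ∧
        (TreeAut.portraitGrowth Apollonian.group n : ℝ) =
          1 / √3 * (7 * √3) ^ (3 ^ n) := by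
  refine ⟨Apollonian.isContracting_group, fun n => ⟨Apollonian.portraitGrowth_eq n, ?_⟩⟩
  rw [Apollonian.portraitGrowth_eq, ← three_pow_mul_seven_pow_eq]
  push_cast
  rfl
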